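/- Let $n\ge 5$. For a set $S$ of transpositions in the symmetric group $S_n$, let $\mathrm{Cay}(S_n,S)$ be the graph with vertex set $S_n$ and edge set $\{\{h,sh\} : h\in S_n,\ s\in S\}$, and let the transposition graph $T(S)$ be the graph with vertex set $\{1,\ldots,n\}$ in which distinct $i$ and $j$ are adjacent if and only if $(i\,j)\in S$. A graph is edge-transitive if for any two edges $\{u,v\}$ and $\{x,y\}$ it has an automorphism $g$ with $\{g(u),g(v)\}=\{x,y\}$. (a) Let $S$ and $S'$ be sets of transpositions, each generating $S_n$. Then the graphs $\mathrm{Cay}(S_n,S)$ and $\mathrm{Cay}(S_n,S')$ are isomorphic if and only if the graphs $T(S)$ and $T(S')$ are isomorphic. (b) Let $S$ be a set of transpositions generating $S_n$. Then $\mathrm{Cay}(S_n,S)$ is edge-transitive if and only if $T(S)$ is edge-transitive. -/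

import Mathlib

/-- The Cayley graph `Cay(H, S)`: vertex set `H`, edges `{h, s * h}` for `h ∈ H`, `s ∈ S`.
The generators multiply on the left (`SimpleGraph.mulCayley` multiplies on the right). -/
def leftCayleyGraph {H : Type*} [Group H] (S : Set H) : SimpleGraph H :=
  SimpleGraph.fromRel fun h k => ∃ s ∈ S, k = s * h

/-- For `S` without the identity, the edges are exactly the pairs `{h, s * h}`. -/
theorem leftCayleyGraph_edgeSet {H : Type*} [Group H] (S : Set H) (h1 : (1 : H) ∉ S) :
    (leftCayleyGraph S).edgeSet = {e | ∃ h : H, ∃ s ∈ S, e = s(h, s * h)} := by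
  ext e
  induction e with
  | _ a b =>
    simp only [leftCayleyGraph, SimpleGraph.mem_edgeSet, SimpleGraph.fromRel_adj,
      Set.mem_ofPred_eq]
    constructor
    · rintro ⟨-, ⟨s, hs, rfl⟩ | ⟨s, hs, rfl⟩⟩
      · exact ⟨a, s, hs, rfl⟩
      · exact ⟨b, s, hs, Sym2.eq_swap⟩
    · rintro ⟨h, s, hs, he⟩
      have hne : s ≠ 1 := fun h' => h1 (h' ▸ hs)
      rcases Sym2.eq_iff.1 he with ⟨rfl, rfl⟩ | ⟨rfl, rfl⟩
      · exact ⟨by simpa using hne, Or.inl ⟨s, hs, rfl⟩⟩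
      · exact ⟨by simpa using hne, Or.inr ⟨s, hs, rfl⟩⟩

/-- The transposition graph `T(S)` of a set `S` of permutations of `{0, …, n - 1}`: distinct
vertices `i`, `j` are adjacent when the transposition `(i j)` belongs to `S`. -/
def transpositionGraph {n : ℕ} (S : Set (Equiv.Perm (Fin n))) : SimpleGraph (Fin n) where
  Adj i j := i ≠ j ∧ Equiv.swap i j ∈ S
  symm := ⟨fun i j h => ⟨h.1.symm, Equiv.swap_comm i j ▸ h.2⟩⟩
  loopless := ⟨fun _ h => h.1 rfl⟩

/-- A graph is edge-transitive if for any two edges `{u, v}`, `{x, y}` some automorphism takes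
the first to the second. -/
def IsEdgeTransitive {V : Type*} (G : SimpleGraph V) : Prop :=
  ∀ u v x y : V, G.Adj u v → G.Adj x y → ∃ g : G ≃g G, s(g u, g v) = s(x, y)

/-!
An isomorphism of transposition graphs extends, by conjugation, to an isomorphism of Cayley graphs
fixing `1` (`exists_leftCayleyGraph_iso`), and right translations make Cayley graphs
vertex-transitive. Both nontrivial directions therefore come down to the converse: an isomorphism
`φ : Cay(S) ≃g Cay(S')` with `φ 1 = 1` is, on the neighbourhood `S` of `1`, induced by an
isomorphism `T(S) ≃g T(S')` of the transposition graphs (`exists_transpositionGraph_iso`).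

Restricted to `S`, such a `φ` is a bijection from the edges of `T(S)` to those of `T(S')`. For
distinct `s, t ∈ S`, the common neighbours of `1` and `s * t` are `s` and `t` if these are disjoint
(`eq_or_eq_of_mul_eq_of_disjoint`). If they overlap, the common neighbours are `s`, `t` and
`s * t * s` when the third edge of the triangle is in `S`, and `t` alone otherwise
(`eq_of_mul_eq_of_not_disjoint`). Counting common neighbours hence shows that `φ` preserves
disjointness of edges, and triangles go to triangles (`leftCayleyGraph_iso_preservesIncidence`).

Whitney's theorem on line graphs is easy for such an edge bijection, because the confusion of
triangles with claws, the source of all its exceptions, is excluded. Pairwise meeting edges that do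
not form a triangle have a common vertex, so the edges at a vertex of degree at least two are
mapped onto the edges at some vertex; a leaf goes to the far end of the image of its edge
(`PreservesIncidence.exists_star`). Since `S` generates the symmetric group on at least three
points, a vertex is determined by the edges at it (`eq_of_star_eq`), and this correspondence of
stars is the desired isomorphism.
-/

open Equiv Equiv.Perm

/-! ### Products of two transpositions -/

theorem isSwap_eq_of_apply_ne {α : Type*} [DecidableEq α] {s : Perm α} (hs : s.IsSwap) {x : α}
    (hx : s x ≠ x) : s = swap x (s x) := by
  obtain ⟨a, b, hab, rfl⟩ := hs
  by_cases hxa : x = a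
  · subst hxa; simp
  · by_cases hxb : x = b
    · subst hxb; simp [swap_comm]
    · exact absurd (swap_apply_of_ne_of_ne hxa hxb) hx

theorem isSwap_mul_self {α : Type*} [DecidableEq α] {s : Perm α} (hs : s.IsSwap) : s * s = 1 := by
  obtain ⟨a, b, -, rfl⟩ := hs
  exact swap_mul_self a b

theorem isSwap_inv {α : Type*} [DecidableEq α] {s : Perm α} (hs : s.IsSwap) : s⁻¹ = s :=
  inv_eq_of_mul_eq_one_left (isSwap_mul_self hs)

theorem isSwap_eq_of_common_points {α : Type*} [DecidableEq α] {s t : Perm α} (hs : s.IsSwap)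
    (ht : t.IsSwap) {x y : α} (hxy : x ≠ y) (hsx : s x ≠ x) (hsy : s y ≠ y) (htx : t x ≠ x)
    (hty : t y ≠ y) : s = t := by
  have key : ∀ r : Perm α, r.IsSwap → r x ≠ x → r y ≠ y → r = swap x y := by
    intro r hr hx hy
    have h := isSwap_eq_of_apply_ne hr hx
    have : r x = y := by
      by_contra hne
      apply hy
      rw [h]
      exact swap_apply_of_ne_of_ne (Ne.symm hxy) (Ne.symm hne)
    rw [h, this]
  rw [key s hs hsx hsy, key t ht htx hty]

theorem not_disjoint_iff_exists {α : Type*} {s t : Perm α} :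
    ¬ s.Disjoint t ↔ ∃ x, s x ≠ x ∧ t x ≠ x := by
  simp [Equiv.Perm.Disjoint]

/-- Two distinct overlapping transpositions have the form `(x a)`, `(x b)`. -/
theorem exists_swap_swap {α : Type*} [DecidableEq α] {s t : Perm α} (hs : s.IsSwap)
    (ht : t.IsSwap) (hst : s ≠ t) {x : α} (hsx : s x ≠ x) (htx : t x ≠ x) :
    ∃ a b, a ≠ x ∧ b ≠ x ∧ a ≠ b ∧ s = swap x a ∧ t = swap x b := by
  have h1 := isSwap_eq_of_apply_ne hs hsx
  have h2 := isSwap_eq_of_apply_ne ht htx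
  refine ⟨s x, t x, hsx, htx, fun h => hst ?_, h1, h2⟩
  rw [h1, h2, h]

theorem swap_mul_swap_mul_swap_of_ne {α : Type*} [DecidableEq α] {x a b : α} (ha : a ≠ x)
    (hb : b ≠ x) (hab : a ≠ b) : swap x a * swap x b * swap x a = swap a b := by
  ext z
  simp only [Perm.mul_apply, swap_apply_def]
  split_ifs <;> simp_all

theorem braid_of_not_disjoint {α : Type*} [DecidableEq α] {s t : Perm α} (hs : s.IsSwap)
    (ht : t.IsSwap) (hst : s ≠ t) (hd : ¬ s.Disjoint t) : s * t * s = t * s * t := by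
  obtain ⟨x, hsx, htx⟩ := not_disjoint_iff_exists.1 hd
  obtain ⟨a, b, ha, hb, hab, rfl, rfl⟩ := exists_swap_swap hs ht hst hsx htx
  rw [swap_mul_swap_mul_swap_of_ne ha hb hab, swap_mul_swap_mul_swap_of_ne hb ha hab.symm,
    swap_comm]

theorem conj_apply_eq_of_common_point {α : Type*} [DecidableEq α] {s t : Perm α} (hs : s.IsSwap)
    (ht : t.IsSwap) (hst : s ≠ t) {x : α} (hsx : s x ≠ x) (htx : t x ≠ x) :
    (s * t * s) x = x := by
  obtain ⟨a, b, ha, hb, hab, rfl, rfl⟩ := exists_swap_swap hs ht hst hsx htx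
  rw [swap_mul_swap_mul_swap_of_ne ha hb hab]
  exact swap_apply_of_ne_of_ne ha.symm hb.symm

/-- An edge that meets both `(x a)` and `(x b)` away from `x` closes the triangle. -/
theorem eq_conj_of_meets {α : Type*} [DecidableEq α] {s t r : Perm α} (hs : s.IsSwap)
    (ht : t.IsSwap) (hr : r.IsSwap) (hst : s ≠ t) {x : α} (hsx : s x ≠ x) (htx : t x ≠ x)
    (hrx : r x = x) (hrs : ¬ r.Disjoint s) (hrt : ¬ r.Disjoint t) : r = s * t * s := by
  obtain ⟨a, b, ha, hb, hab, rfl, rfl⟩ := exists_swap_swap hs ht hst hsx htx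
  rw [swap_mul_swap_mul_swap_of_ne ha hb hab]
  have key : ∀ c, ¬ r.Disjoint (swap x c) → r c ≠ c := by
    intro c hc
    obtain ⟨y, hy, hy'⟩ := not_disjoint_iff_exists.1 hc
    have hyx : y ≠ x := fun h => hy (h ▸ hrx)
    have : y = c := by
      by_contra hne
      exact hy' (swap_apply_of_ne_of_ne hyx hne)
    exact this ▸ hy
  refine isSwap_eq_of_common_points hr ⟨a, b, hab, rfl⟩ hab (key a hrs) (key b hrt) ?_ ?_ <;>
    simp [hab, hab.symm]

/-- A product of two disjoint transpositions determines the two factors. -/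
theorem eq_or_eq_of_mul_eq_of_disjoint {α : Type*} [Fintype α] [DecidableEq α]
    {s t q r : Perm α} (hs : s.IsSwap) (ht : t.IsSwap) (hq : q.IsSwap) (hr : r.IsSwap)
    (hd : s.Disjoint t) (h : s * t = q * r) : r = s ∨ r = t := by
  have hqr : q.Disjoint r := by
    rw [disjoint_iff_disjoint_support, Finset.disjoint_iff_inter_eq_empty, ← Finset.card_eq_zero]
    have h4 := hd.card_support_mul
    have hle := Finset.card_le_card (support_mul_le q r)
    have hu := Finset.card_union_add_card_inter q.support r.support
    rw [card_support_eq_two.2 hs, card_support_eq_two.2 ht, h] at h4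
    rw [card_support_eq_two.2 hq, card_support_eq_two.2 hr] at hu
    simp only [Finset.sup_eq_union] at hle
    omega
  obtain ⟨x, hx⟩ : ∃ x, r x ≠ x := by
    obtain ⟨a, b, hab, rfl⟩ := hr
    exact ⟨a, by simpa using hab.symm⟩
  have hrx : (s * t) x = r x := by
    rw [h, Perm.mul_apply]
    exact (hqr (r x)).resolve_right fun h' => hx (r.injective h')
  have key : ∀ p : Perm α, p.IsSwap → p x = r x → r = p := fun p hp hpx => by
    rw [isSwap_eq_of_apply_ne hr hx, isSwap_eq_of_apply_ne hp (x := x) (hpx ▸ hx), hpx]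
  rcases hd x with hsx | htx
  · right
    rw [hd.commute.eq, Perm.mul_apply, hsx] at hrx
    exact key t ht hrx
  · left
    rw [Perm.mul_apply, htx] at hrx
    exact key s hs hrx

/-- The three-cycle `(x a)(x b)` factors into transpositions only inside the triangle `x a b`. -/
theorem eq_of_mul_eq_of_not_disjoint {α : Type*} [Fintype α] [DecidableEq α]
    {s t q r : Perm α} (hs : s.IsSwap) (ht : t.IsSwap) (hq : q.IsSwap) (hr : r.IsSwap)
    (hst : s ≠ t) (hd : ¬ s.Disjoint t) (h : s * t = q * r) :
    r = s ∨ r = t ∨ r = s * t * s := by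
  have hqr : q ≠ r := by
    rintro rfl
    rw [isSwap_mul_self hq] at h
    exact hst (by rw [← isSwap_inv ht]; exact eq_inv_of_mul_eq_one_left h)
  have hqrd : ¬ q.Disjoint r := by
    intro hdqr
    rcases eq_or_eq_of_mul_eq_of_disjoint hq hr hs ht hdqr h.symm with rfl | rfl
    · have : s = r := by
        rw [hdqr.commute.eq] at h
        exact mul_right_cancel h
      exact hd (this ▸ hdqr.symm)
    · exact hd (mul_right_cancel h ▸ hdqr)
  obtain ⟨x, hsx, htx⟩ := not_disjoint_iff_exists.1 hd
  obtain ⟨a, b, ha, hb, hab, rfl, rfl⟩ := exists_swap_swap hs ht hst hsx htx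
  obtain ⟨y, hqy, hry⟩ := not_disjoint_iff_exists.1 hqrd
  obtain ⟨c, d, hc, hd', hcd, rfl, rfl⟩ := exists_swap_swap hq hr hqr hqy hry
  have hout : ∀ z, z ≠ x → z ≠ a → z ≠ b → (swap x a * swap x b) z = z := by
    intro z h1 h2 h3
    rw [Perm.mul_apply, swap_apply_of_ne_of_ne h1 h3, swap_apply_of_ne_of_ne h1 h2]
  have hy : y = x ∨ y = a ∨ y = b := by
    by_contra! hne
    have := hout y hne.1 hne.2.1 hne.2.2
    rw [h, Perm.mul_apply, swap_apply_left, swap_apply_of_ne_of_ne hd' hcd.symm] at this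
    exact hd' this
  have hdd : d = x ∨ d = a ∨ d = b := by
    by_contra! hne
    have := hout d hne.1 hne.2.1 hne.2.2
    rw [h, Perm.mul_apply, swap_apply_right, swap_apply_left] at this
    exact hcd this
  rw [swap_mul_swap_mul_swap_of_ne ha hb hab]
  rcases hy with rfl | rfl | rfl <;> rcases hdd with rfl | rfl | rfl <;>
    simp_all [swap_comm]

/-! ### Bijections of edges that preserve incidence and triangles -/

/-- The bijection `f` restricts to a bijection from `S` to `S'` that preserves disjointness and
triangles. For sets of transpositions this is an isomorphism between the line graphs of `T(S)` and
`T(S')` that distinguishes triangles from claws. The elements outside `S` play no role; `f` is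
defined on them so that it can be the bijection underlying a map of Cayley graphs. -/
structure PreservesIncidence {α : Type*} (S S' : Set (Perm α)) (f : Perm α ≃ Perm α) : Prop where
  mem_iff : ∀ s, f s ∈ S' ↔ s ∈ S
  disjoint_iff : ∀ s ∈ S, ∀ t ∈ S, ((f s).Disjoint (f t) ↔ s.Disjoint t)
  triangle_iff : ∀ s ∈ S, ∀ t ∈ S, ∀ r ∈ S, s ≠ t → ¬ s.Disjoint t →
    (f r = f s * f t * f s ↔ r = s * t * s)

theorem PreservesIncidence.symm {α : Type*} {S S' : Set (Perm α)} {f : Perm α ≃ Perm α}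
    (h : PreservesIncidence S S' f) : PreservesIncidence S' S f.symm := by
  have hm : ∀ s ∈ S', f.symm s ∈ S := fun s hs => by rw [← h.mem_iff]; simpa
  refine ⟨fun s => by rw [← h.mem_iff]; simp, fun s hs t ht => ?_, fun s hs t ht r hr hst hd => ?_⟩
  · simpa using (h.disjoint_iff _ (hm s hs) _ (hm t ht)).symm
  · have hd' : ¬ (f.symm s).Disjoint (f.symm t) := by
      rw [← h.disjoint_iff _ (hm s hs) _ (hm t ht)]; simpa
    simpa using (h.triangle_iff _ (hm s hs) _ (hm t ht) _ (hm r hr)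
      (fun h' => hst (f.symm.injective h')) hd').symm

section Star

variable {α : Type*} [DecidableEq α] {S S' : Set (Perm α)} {f : Perm α ≃ Perm α}

/-- If `y` lies on the images of two edges at `x`, then it lies on the image of every edge at `x`:
the only way to miss it is to close a triangle, which `f` reflects. -/
theorem PreservesIncidence.apply_ne (h : PreservesIncidence S S' f) (hS : ∀ s ∈ S, s.IsSwap)
    (hS' : ∀ s ∈ S', s.IsSwap) {s t r : Perm α} (hs : s ∈ S) (ht : t ∈ S) (hr : r ∈ S)
    (hst : s ≠ t) {x y : α} (hsx : s x ≠ x) (htx : t x ≠ x) (hsy : f s y ≠ y) (hty : f t y ≠ y)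
    (hrx : r x ≠ x) : f r y ≠ y := by
  intro hry
  have hd : ∀ p ∈ S, p x ≠ x → ¬ (f r).Disjoint (f p) := fun p hp hpx => by
    rw [h.disjoint_iff r hr p hp]
    exact not_disjoint_iff_exists.2 ⟨x, hrx, hpx⟩
  have hf : ∀ p ∈ S, (f p).IsSwap := fun p hp => hS' _ ((h.mem_iff p).2 hp)
  have h1 := eq_conj_of_meets (hf s hs) (hf t ht) (hf r hr) (fun h' => hst (f.injective h'))
    hsy hty hry (hd s hs hsx) (hd t ht htx)
  rw [h.triangle_iff s hs t ht r hr hst (not_disjoint_iff_exists.2 ⟨x, hsx, htx⟩)] at h1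
  apply hrx
  rw [h1]
  exact conj_apply_eq_of_common_point (hS s hs) (hS t ht) hst hsx htx

theorem PreservesIncidence.star_iff (h : PreservesIncidence S S' f) (hS : ∀ s ∈ S, s.IsSwap)
    (hS' : ∀ s ∈ S', s.IsSwap) {s t : Perm α} (hs : s ∈ S) (ht : t ∈ S)
    (hst : s ≠ t) {x y : α} (hsx : s x ≠ x) (htx : t x ≠ x) (hsy : f s y ≠ y) (hty : f t y ≠ y)
    {r : Perm α} (hr : r ∈ S) : f r y ≠ y ↔ r x ≠ x := by
  refine ⟨fun hry => ?_, h.apply_ne hS hS' hs ht hr hst hsx htx hsy hty⟩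
  have := h.symm.apply_ne hS' hS ((h.mem_iff s).2 hs) ((h.mem_iff t).2 ht) ((h.mem_iff r).2 hr)
    (fun h' => hst (f.injective h')) hsy hty (y := x) (by simpa) (by simpa) hry
  simpa using this

/-- The edges at `x` are mapped exactly onto the edges at some `y`. The hypotheses `hmov` and `hsep`
say that `T(S)` has no isolated vertex and that distinct vertices have distinct edge sets. -/
theorem PreservesIncidence.exists_star (h : PreservesIncidence S S' f) (hS : ∀ s ∈ S, s.IsSwap)
    (hS' : ∀ s ∈ S', s.IsSwap) (hmov : ∀ x, ∃ s ∈ S, s x ≠ x)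
    (hsep : ∀ x y, (∀ s ∈ S, s x ≠ x ↔ s y ≠ y) → x = y) (x : α) :
    ∃ y, ∀ s ∈ S, (f s y ≠ y ↔ s x ≠ x) := by
  have two : ∀ x, ∀ s ∈ S, ∀ t ∈ S, s ≠ t → s x ≠ x → t x ≠ x →
      ∃ y, (f s y ≠ y) ∧ ∀ r ∈ S, (f r y ≠ y ↔ r x ≠ x) := by
    intro x s hs t ht hst hsx htx
    have hd : ¬ (f s).Disjoint (f t) := by
      rw [h.disjoint_iff s hs t ht]
      exact not_disjoint_iff_exists.2 ⟨x, hsx, htx⟩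
    obtain ⟨y, hy1, hy2⟩ := not_disjoint_iff_exists.1 hd
    exact ⟨y, hy1, fun r hr => h.star_iff hS hS' hs ht hst hsx htx hy1 hy2 hr⟩
  obtain ⟨s, hs, hsx⟩ := hmov x
  by_cases hdeg : ∃ t ∈ S, s ≠ t ∧ t x ≠ x
  · obtain ⟨t, ht, hst, htx⟩ := hdeg
    obtain ⟨y, -, hy⟩ := two x s hs t ht hst hsx htx
    exact ⟨y, hy⟩
  · -- `x` is a leaf with neighbour `s x`; its image is the far end of the image of its edge.
    have hleaf : ∀ t ∈ S, t x ≠ x → t = s := fun t ht htx => by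
      by_contra hne
      exact hdeg ⟨t, ht, Ne.symm hne, htx⟩
    have hsu : s (s x) ≠ s x := fun h' => hsx (s.injective h')
    obtain ⟨t, ht, hts, htu⟩ : ∃ t ∈ S, s ≠ t ∧ t (s x) ≠ s x := by
      by_contra! hno
      refine hsx.symm (hsep x (s x) fun t ht => ?_)
      by_cases hts : s = t
      · subst hts; exact ⟨fun _ => hsu, fun _ => hsx⟩
      · exact ⟨fun htx => absurd (hleaf t ht htx).symm hts, fun htu => absurd (hno t ht hts) htu⟩
    obtain ⟨u, hu, hstar⟩ := two (s x) s hs t ht hts hsu htu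
    have hfsu : f s (f s u) ≠ f s u := fun h' => hu ((f s).injective h')
    refine ⟨f s u, fun r hr => ⟨fun hrv => ?_, fun hrx => hleaf r hr hrx ▸ hfsu⟩⟩
    have hrs : r = s := by
      by_contra hne
      have hd : ¬ r.Disjoint s := by
        rw [← h.disjoint_iff r hr s hs]
        exact not_disjoint_iff_exists.2 ⟨f s u, hrv, hfsu⟩
      obtain ⟨z, hrz, hsz⟩ := not_disjoint_iff_exists.1 hd
      have hzx : z ≠ x := fun hz => hne (hleaf r hr (hz ▸ hrz))
      have hz : z = s x := by
        by_contra hzs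
        apply hsz
        rw [isSwap_eq_of_apply_ne (hS s hs) hsx]
        exact swap_apply_of_ne_of_ne hzx hzs
      have hru := (hstar r hr).2 (hz ▸ hrz)
      exact hne (f.injective (isSwap_eq_of_common_points (hS' _ ((h.mem_iff r).2 hr))
        (hS' _ ((h.mem_iff s).2 hs)) (Ne.symm hu) hru hrv hu hfsu))
    exact hrs ▸ hsx

end Star

/-! ### Generating sets of transpositions -/

section Generating

variable {α : Type*} [DecidableEq α] {S : Set (Perm α)}

theorem exists_apply_ne_of_closure_eq_top (hgen : Subgroup.closure S = ⊤) [Nontrivial α] (x : α) :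
    ∃ s ∈ S, s x ≠ x := by
  by_contra! hno
  obtain ⟨y, hy⟩ := exists_ne x
  have hle : Subgroup.closure S ≤ MulAction.stabilizer (Perm α) x := by
    rw [Subgroup.closure_le]
    intro s hs
    exact hno s hs
  rw [hgen] at hle
  have : swap x y • x = x := hle (Subgroup.mem_top _)
  rw [Perm.smul_def, swap_apply_left] at this
  exact hy this

/-- If every edge at `x` or `y` contains both, then `{x, y}` is invariant under the group
generated by `S`, which is impossible in the presence of a third point. -/
theorem eq_of_star_eq (hS : ∀ s ∈ S, s.IsSwap) (hgen : Subgroup.closure S = ⊤)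
    (h3 : ∀ x y : α, ∃ z, z ≠ x ∧ z ≠ y) (x y : α)
    (hxy : ∀ s ∈ S, s x ≠ x ↔ s y ≠ y) : x = y := by
  by_contra hne
  obtain ⟨z, hzx, hzy⟩ := h3 x y
  have hinv : ∀ g ∈ Subgroup.closure S, Sym2.map g s(x, y) = s(x, y) := by
    intro g hg
    induction hg using Subgroup.closure_induction with
    | mem s hs =>
      rw [Sym2.map_mk]
      by_cases hsx : s x = x
      · have hsy : s y = y := by
          by_contra hsy
          exact (hxy s hs).2 hsy hsx
        rw [hsx, hsy]
      · have hsy := (hxy s hs).1 hsx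
        have hs' := isSwap_eq_of_common_points (hS s hs) ⟨x, y, hne, rfl⟩ hne hsx hsy
          (by simpa using Ne.symm hne) (by simpa using hne)
        rw [hs', swap_apply_left, swap_apply_right, Sym2.eq_swap]
    | one => simp
    | mul g h _ _ hg hh =>
      rw [Perm.coe_mul, ← Sym2.map_map, hh, hg]
    | inv g _ hg =>
      conv_lhs => rw [← hg]
      simp [Sym2.map_mk]
  have := hinv (swap x z) (hgen ▸ Subgroup.mem_top _)
  rw [Sym2.map_mk, swap_apply_left, swap_apply_of_ne_of_ne (Ne.symm hne) (Ne.symm hzy)] at this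
  simp [hzx, hzy] at this

end Generating

/-! ### Isomorphisms of Cayley graphs that fix the identity -/

theorem leftCayleyGraph_adj_iff {α : Type*} [DecidableEq α] {S : Set (Perm α)}
    (hS : ∀ s ∈ S, s.IsSwap) {h k : Perm α} : (leftCayleyGraph S).Adj h k ↔ k * h⁻¹ ∈ S := by
  have hinv : ∀ g : Perm α, g⁻¹ ∈ S → g ∈ S := fun g hg => by
    have := isSwap_inv (hS _ hg)
    rw [inv_inv] at this
    exact this.symm ▸ hg
  simp only [leftCayleyGraph, SimpleGraph.fromRel_adj]
  constructor
  · rintro ⟨-, ⟨s, hs, rfl⟩ | ⟨s, hs, rfl⟩⟩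
    · simpa using hs
    · exact hinv _ (by simpa using hs)
  · intro hk
    refine ⟨?_, Or.inl ⟨_, hk, by simp⟩⟩
    rintro rfl
    obtain ⟨a, b, hab, h'⟩ := hS _ hk
    rw [mul_inv_cancel] at h'
    exact hab (swap_eq_one_iff.1 h'.symm)

section Isomorphism

variable {α : Type*} [DecidableEq α] {S S' : Set (Perm α)}

theorem leftCayleyGraph_iso_mem_iff (hS : ∀ s ∈ S, s.IsSwap) (hS' : ∀ s ∈ S', s.IsSwap)
    (φ : leftCayleyGraph S ≃g leftCayleyGraph S') (h1 : φ 1 = 1) (s : Perm α) :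
    φ s ∈ S' ↔ s ∈ S := by
  have := φ.map_adj_iff (v := 1) (w := s)
  rw [leftCayleyGraph_adj_iff hS, leftCayleyGraph_adj_iff hS', h1] at this
  simpa using this

/-- For `r ∈ S`, the vertex `r` is adjacent to `w` when `w * r ∈ S`; so the common neighbours of
`1` and `w` correspond to those of `1` and `φ w`. -/
theorem leftCayleyGraph_iso_mul_mem_iff (hS : ∀ s ∈ S, s.IsSwap) (hS' : ∀ s ∈ S', s.IsSwap)
    (φ : leftCayleyGraph S ≃g leftCayleyGraph S') (h1 : φ 1 = 1) {r : Perm α} (hr : r ∈ S)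
    (w : Perm α) : φ w * φ r ∈ S' ↔ w * r ∈ S := by
  have := φ.map_adj_iff (v := r) (w := w)
  rw [leftCayleyGraph_adj_iff hS, leftCayleyGraph_adj_iff hS', isSwap_inv (hS r hr),
    isSwap_inv (hS' _ ((leftCayleyGraph_iso_mem_iff hS hS' φ h1 r).2 hr))] at this
  exact this

variable [Fintype α]

/-- Elements `s ≠ t` of `S` are disjoint exactly when they are all the common neighbours of
`1` and some other vertex: overlapping `s`, `t` give one or three common neighbours. -/
theorem leftCayleyGraph_iso_disjoint (hS : ∀ s ∈ S, s.IsSwap) (hS' : ∀ s ∈ S', s.IsSwap)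
    (φ : leftCayleyGraph S ≃g leftCayleyGraph S') (h1 : φ 1 = 1) {s t : Perm α} (hs : s ∈ S)
    (ht : t ∈ S) (hd : s.Disjoint t) : (φ s).Disjoint (φ t) := by
  have hm := leftCayleyGraph_iso_mem_iff hS hS' φ h1
  have hN {r : Perm α} (hr : r ∈ S) (w : Perm α) :=
    leftCayleyGraph_iso_mul_mem_iff hS hS' φ h1 hr w
  have hst : s ≠ t := by
    rintro rfl
    have := disjoint_refl_iff.1 hd
    obtain ⟨a, b, hab, h'⟩ := hS s hs
    exact hab (swap_eq_one_iff.1 (h'.symm.trans this))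
  have hss := isSwap_mul_self (hS s hs)
  have htt := isSwap_mul_self (hS t ht)
  have hw1 : φ (s * t) ≠ 1 := by
    rw [← h1]
    intro h'
    have := φ.injective h'
    exact hst (by rw [← isSwap_inv (hS t ht)]; exact eq_inv_of_mul_eq_one_left this)
  -- the only common neighbours of `1` and `φ (s * t)` are `φ s` and `φ t`
  have hall : ∀ r ∈ S', φ (s * t) * r ∈ S' → r = φ s ∨ r = φ t := by
    intro r hr hwr
    obtain ⟨r, rfl⟩ := φ.surjective r
    have hr' := (hm r).1 hr
    have hq := (hN hr' _).1 hwr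
    have := eq_or_eq_of_mul_eq_of_disjoint (hS s hs) (hS t ht) (hS _ hq) (hS r hr') hd
      (by rw [mul_assoc, isSwap_mul_self (hS r hr'), mul_one])
    exact this.imp (congrArg φ) (congrArg φ)
  have hqS : φ (s * t) * φ s ∈ S' := by
    rw [hN hs, hd.commute.eq, mul_assoc, hss, mul_one]; exact ht
  have hq2S : φ (s * t) * φ t ∈ S' := by
    rw [hN ht, mul_assoc, htt, mul_one]; exact hs
  have hpS := (hm s).2 hs
  have hp2S := (hm t).2 ht
  have hp12 : φ s ≠ φ t := fun h' => hst (φ.injective h')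
  generalize φ (s * t) = w at *
  generalize φ s = p at *
  generalize φ t = p₂ at *
  obtain ⟨q, rfl⟩ : ∃ q, w = q * p := ⟨w * p⁻¹, by simp⟩
  have hpp := isSwap_mul_self (hS' p hpS)
  rw [mul_assoc, hpp, mul_one] at hqS
  have hqq := isSwap_mul_self (hS' q hqS)
  have hqp : q ≠ p := fun h' => hw1 (by rw [h', hpp])
  by_cases hdq : q.Disjoint p
  · have : q * p * q ∈ S' := by rwa [hdq.commute.eq, mul_assoc, hqq, mul_one]
    rcases hall q hqS this with h' | h'
    · exact absurd h' hqp
    · exact h' ▸ hdq.symm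
  · exfalso
    have hbraid := braid_of_not_disjoint (hS' q hqS) (hS' p hpS) hqp hdq
    -- the third edge of the triangle would be a further common neighbour
    have hthird : q * p * q ∈ S' → False := by
      intro h3
      have hmem : q * p * (q * p * q) ∈ S' := by
        have : q * p * (q * p * q) = p := by
          rw [hbraid, ← mul_assoc, mul_assoc q p, ← mul_assoc p p, hpp, one_mul, hqq,
            one_mul]
        rwa [this]
      have hne : q * p * q ≠ p := by
        intro h'
        rw [hbraid, mul_assoc, mul_eq_left] at h'
        exact hqp (by rw [← isSwap_inv (hS' p hpS)]; exact eq_inv_of_mul_eq_one_left h')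
      have hne' : q * p * q ≠ q := by
        intro h'
        rw [mul_eq_right] at h'
        exact hw1 h'
      rcases hall q hqS h3 with h' | h'
      · exact hqp h'
      · rcases hall _ h3 hmem with h'' | h''
        · exact hne h''
        · exact hne' (h''.trans h'.symm)
    rcases eq_of_mul_eq_of_not_disjoint (hS' q hqS) (hS' p hpS) (hS' _ hq2S) (hS' _ hp2S) hqp hdq
      (by rw [mul_assoc, isSwap_mul_self (hS' _ hp2S), mul_one]) with h' | h' | h'
    · exact hthird (h' ▸ hq2S)
    · exact hp12 h'.symm
    · exact hthird (h' ▸ hp2S)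

/-- If `s`, `t` and `s * t * s` form a triangle, they are the three common neighbours of `1` and
`s * t`, so their images form a triangle as well. -/
theorem leftCayleyGraph_iso_triangle (hS : ∀ s ∈ S, s.IsSwap) (hS' : ∀ s ∈ S', s.IsSwap)
    (φ : leftCayleyGraph S ≃g leftCayleyGraph S') (h1 : φ 1 = 1) {s t : Perm α} (hs : s ∈ S)
    (ht : t ∈ S) (hr : s * t * s ∈ S) (hst : s ≠ t) (hd : ¬ s.Disjoint t) :
    φ (s * t * s) = φ s * φ t * φ s := by
  have hm := leftCayleyGraph_iso_mem_iff hS hS' φ h1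
  have hN {r : Perm α} (hr : r ∈ S) (w : Perm α) :=
    leftCayleyGraph_iso_mul_mem_iff hS hS' φ h1 hr w
  have hss := isSwap_mul_self (hS s hs)
  have htt := isSwap_mul_self (hS t ht)
  have hbraid := braid_of_not_disjoint (hS s hs) (hS t ht) hst hd
  have hst1 : s * t ≠ 1 := fun h' =>
    hst (by rw [← isSwap_inv (hS t ht)]; exact eq_inv_of_mul_eq_one_left h')
  have hrs : s * t * s ≠ s := by
    rw [Ne, mul_eq_right]; exact hst1
  have hrt : s * t * s ≠ t := by
    rw [hbraid, mul_assoc, Ne, mul_eq_left]; exact hst1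
  have hw1 : φ (s * t) ≠ 1 := by
    rw [← h1]; exact fun h' => hst1 (φ.injective h')
  have hsN : φ (s * t) * φ s ∈ S' := (hN hs _).2 hr
  have htN : φ (s * t) * φ t ∈ S' := by
    rw [hN ht, mul_assoc, htt, mul_one]; exact hs
  have hrN : φ (s * t) * φ (s * t * s) ∈ S' := by
    rw [hN hr]
    have : s * t * (s * t * s) = t := by
      rw [hbraid, ← mul_assoc, mul_assoc s t, ← mul_assoc t t, htt, one_mul, hss,
        one_mul]
    rwa [this]
  have hpS := (hm s).2 hs
  have hp2S := (hm t).2 ht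
  have hp3S := (hm _).2 hr
  have hp12 : φ t ≠ φ s := fun h' => hst (φ.injective h').symm
  have hp13 : φ (s * t * s) ≠ φ s := fun h' => hrs (φ.injective h')
  have hp23 : φ (s * t * s) ≠ φ t := fun h' => hrt (φ.injective h')
  generalize φ (s * t * s) = p₃ at *
  generalize φ (s * t) = w at *
  generalize φ s = p at *
  generalize φ t = p₂ at *
  obtain ⟨q, rfl⟩ : ∃ q, w = q * p := ⟨w * p⁻¹, by simp⟩
  have hpp := isSwap_mul_self (hS' p hpS)
  rw [mul_assoc, hpp, mul_one] at hsN
  have hqp : q ≠ p := fun h' => hw1 (by rw [h', hpp])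
  have hfac : ∀ r ∈ S', q * p = q * p * r * r := fun r hr' => by
    rw [mul_assoc, isSwap_mul_self (hS' r hr'), mul_one]
  by_cases hdq : q.Disjoint p
  · have h2 := eq_or_eq_of_mul_eq_of_disjoint (hS' q hsN) (hS' p hpS) (hS' _ htN) (hS' _ hp2S) hdq
      (hfac _ hp2S)
    have h3 := eq_or_eq_of_mul_eq_of_disjoint (hS' q hsN) (hS' p hpS) (hS' _ hrN) (hS' _ hp3S) hdq
      (hfac _ hp3S)
    exact absurd ((h3.resolve_right hp13).trans (h2.resolve_right hp12).symm) hp23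
  · have hb := braid_of_not_disjoint (hS' q hsN) (hS' p hpS) hqp hdq
    have h2 := eq_of_mul_eq_of_not_disjoint (hS' q hsN) (hS' p hpS) (hS' _ htN) (hS' _ hp2S) hqp
      hdq (hfac _ hp2S)
    have h3 := eq_of_mul_eq_of_not_disjoint (hS' q hsN) (hS' p hpS) (hS' _ hrN) (hS' _ hp3S) hqp
      hdq (hfac _ hp3S)
    rcases h2 with rfl | h2 | h2
    · rcases h3 with h3 | h3 | h3
      · exact absurd h3 hp23
      · exact absurd h3 hp13
      · rw [h3, hb]
    · exact absurd h2 hp12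
    · rcases h3 with rfl | h3 | h3
      · rw [h2, hb, ← mul_assoc, ← mul_assoc, hpp, one_mul, mul_assoc, hpp, mul_one]
      · exact absurd h3 hp13
      · exact absurd (h3.trans h2.symm) hp23

theorem leftCayleyGraph_iso_preservesIncidence (hS : ∀ s ∈ S, s.IsSwap)
    (hS' : ∀ s ∈ S', s.IsSwap) (φ : leftCayleyGraph S ≃g leftCayleyGraph S') (h1 : φ 1 = 1) :
    PreservesIncidence S S' φ.toEquiv := by
  have hm := leftCayleyGraph_iso_mem_iff hS hS' φ h1
  have h1' : φ.symm 1 = 1 := (φ.symm_apply_eq).2 h1.symm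
  have hdisj : ∀ s ∈ S, ∀ t ∈ S, ((φ s).Disjoint (φ t) ↔ s.Disjoint t) := by
    refine fun s hs t ht => ⟨fun h' => ?_, leftCayleyGraph_iso_disjoint hS hS' φ h1 hs ht⟩
    have := leftCayleyGraph_iso_disjoint hS' hS φ.symm h1' ((hm s).2 hs) ((hm t).2 ht) h'
    simpa using this
  refine ⟨hm, hdisj, fun s hs t ht r hr hst hd => ⟨fun h' => ?_, fun h' => ?_⟩⟩
  · have h' : φ r = φ s * φ t * φ s := h'
    have := leftCayleyGraph_iso_triangle hS' hS φ.symm h1' ((hm s).2 hs) ((hm t).2 ht)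
      (h' ▸ (hm r).2 hr) (fun e => hst (φ.injective e)) (by rwa [hdisj s hs t ht])
    rw [← h'] at this
    simpa using this
  · subst h'
    exact leftCayleyGraph_iso_triangle hS hS' φ h1 hs ht hr hst hd

end Isomorphism

/-! ### Cayley graphs and transposition graphs -/

section Vertices

variable {n : ℕ} {S S' : Set (Perm (Fin n))}

/-- An isomorphism of Cayley graphs fixing `1` is induced, on the neighbours of `1`, by an
isomorphism of the transposition graphs. -/
theorem exists_transpositionGraph_iso (hn : 3 ≤ n) (hS : ∀ s ∈ S, s.IsSwap)
    (hgen : Subgroup.closure S = ⊤) (hS' : ∀ s ∈ S', s.IsSwap) (hgen' : Subgroup.closure S' = ⊤)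
    (φ : leftCayleyGraph S ≃g leftCayleyGraph S') (h1 : φ 1 = 1) :
    ∃ σ : transpositionGraph S ≃g transpositionGraph S',
      ∀ i j, (transpositionGraph S).Adj i j → φ (swap i j) = swap (σ i) (σ j) := by
  have h3 : ∀ x y : Fin n, ∃ z, z ≠ x ∧ z ≠ y := fun x y => by
    obtain ⟨z, hz⟩ := Finset.exists_mem_notMem_of_card_lt_card (s := {x, y})
      (t := (Finset.univ : Finset (Fin n)))
      (by rw [Finset.card_fin]; exact lt_of_le_of_lt Finset.card_le_two hn)
    exact ⟨z, by simpa using hz.2⟩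
  have : Nontrivial (Fin n) := Fin.nontrivial_iff_two_le.2 (by omega)
  have hsep := eq_of_star_eq hS hgen h3
  have hsep' := eq_of_star_eq hS' hgen' h3
  have hf := leftCayleyGraph_iso_preservesIncidence hS hS' φ h1
  choose σ hσ using hf.exists_star hS hS' (exists_apply_ne_of_closure_eq_top hgen) hsep
  choose τ hτ using hf.symm.exists_star hS' hS (exists_apply_ne_of_closure_eq_top hgen') hsep'
  have hm : ∀ s ∈ S, φ s ∈ S' := fun s hs => (hf.mem_iff s).2 hs
  have hm' : ∀ s ∈ S', φ.symm s ∈ S := fun s hs => (hf.symm.mem_iff s).2 hs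
  have hτσ : ∀ x, τ (σ x) = x := fun x => hsep _ _ fun s hs => by
    have := hτ (σ x) (φ s) (hm s hs)
    rw [show φ.toEquiv.symm (φ s) = s from φ.toEquiv.symm_apply_apply s] at this
    exact this.trans (hσ x s hs)
  have hστ : ∀ y, σ (τ y) = y := fun y => hsep' _ _ fun s hs => by
    have := hσ (τ y) (φ.symm s) (hm' s hs)
    rw [show φ.toEquiv (φ.symm s) = s from φ.toEquiv.apply_symm_apply s] at this
    exact this.trans (hτ y s hs)
  -- a vertex map compatible with stars induces the given map of edges
  have key : ∀ (T : Set (Perm (Fin n))) (g : Perm (Fin n) → Perm (Fin n)) (ρ : Fin n → Fin n),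
      Function.Injective ρ → (∀ s ∈ T, (g s).IsSwap) →
      (∀ x, ∀ s ∈ T, (g s (ρ x) ≠ ρ x ↔ s x ≠ x)) →
      ∀ i j, i ≠ j → swap i j ∈ T → g (swap i j) = swap (ρ i) (ρ j) := by
    intro T g ρ hinj hg hρ i j hij hT
    have hne : ρ i ≠ ρ j := fun e => hij (hinj e)
    exact isSwap_eq_of_common_points (hg _ hT) ⟨_, _, hne, rfl⟩ hne
      ((hρ i _ hT).2 (by simpa using hij.symm)) ((hρ j _ hT).2 (by simpa using hij))
      (by simpa using hne.symm) (by simpa using hne)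
  have hσinj : Function.Injective σ := Function.LeftInverse.injective hτσ
  have hτinj : Function.Injective τ := Function.LeftInverse.injective hστ
  have hedge := key S φ σ hσinj (fun s hs => hS' _ (hm s hs)) hσ
  have hedge' := key S' φ.symm τ hτinj (fun s hs => hS _ (hm' s hs)) hτ
  refine ⟨⟨⟨σ, τ, hτσ, hστ⟩, fun {i j} => ⟨fun h => ?_, fun h => ?_⟩⟩, fun i j h =>
    hedge i j h.1 h.2⟩
  · obtain ⟨hne, hmem⟩ := h
    simp only [Equiv.coe_fn_mk] at hne hmem
    refine ⟨fun e => hne (e ▸ rfl), ?_⟩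
    have := hm' _ hmem
    rwa [hedge' _ _ hne hmem, hτσ, hτσ] at this
  · refine ⟨fun e => h.1 (hσinj e), ?_⟩
    have := hm _ h.2
    rwa [hedge _ _ h.1 h.2] at this

/-- Right translation, an automorphism because the generators multiply on the left. -/
def leftCayleyGraph.mulRightIso {H : Type*} [Group H] (S : Set H) (h : H) :
    leftCayleyGraph S ≃g leftCayleyGraph S where
  toEquiv := Equiv.mulRight h
  map_rel_iff' := by
    intro a b
    simp [leftCayleyGraph, ← mul_assoc]

/-- Conjugation by an isomorphism of transposition graphs. -/
theorem exists_leftCayleyGraph_iso (hS : ∀ s ∈ S, s.IsSwap) (hS' : ∀ s ∈ S', s.IsSwap)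
    (σ : transpositionGraph S ≃g transpositionGraph S') :
    ∃ φ : leftCayleyGraph S ≃g leftCayleyGraph S',
      φ 1 = 1 ∧ ∀ i j, φ (swap i j) = swap (σ i) (σ j) := by
  have hconj : ∀ i j, MulAut.conj (σ.toEquiv : Perm (Fin n)) (swap i j) = swap (σ i) (σ j) :=
    fun i j => (Equiv.swap_apply_apply σ.toEquiv i j).symm
  have hmem : ∀ g, MulAut.conj (σ.toEquiv : Perm (Fin n)) g ∈ S' ↔ g ∈ S := by
    have hsw : ∀ i j, i ≠ j → (swap (σ i) (σ j) ∈ S' ↔ swap i j ∈ S) := fun i j hij => by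
      have := σ.map_adj_iff (v := i) (w := j)
      have hne : σ i ≠ σ j := fun e => hij (σ.injective e)
      simp only [transpositionGraph, ne_eq] at this
      tauto
    intro g
    constructor
    · intro hg
      obtain ⟨a, b, hab, he⟩ := hS' _ hg
      obtain ⟨i, rfl⟩ := σ.surjective a
      obtain ⟨j, rfl⟩ := σ.surjective b
      have hij : i ≠ j := fun e => hab (e ▸ rfl)
      rw [← hconj] at he
      rw [(MulAut.conj (σ.toEquiv : Perm (Fin n))).injective he, ← hsw i j hij, ← hconj, ← he]
      exact hg
    · intro hg
      obtain ⟨i, j, hij, rfl⟩ := hS _ hg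
      rw [hconj, hsw i j hij]
      exact hg
  refine ⟨⟨(MulAut.conj (σ.toEquiv : Perm (Fin n))).toEquiv, fun {a b} => ?_⟩,
    map_one (MulAut.conj (σ.toEquiv : Perm (Fin n))), hconj⟩
  rw [leftCayleyGraph_adj_iff hS, leftCayleyGraph_adj_iff hS', ← hmem (b * a⁻¹), map_mul, map_inv]
  rfl

end Vertices

theorem theorem1 (n : ℕ) (hn : 5 ≤ n) :
    (∀ S S' : Set (Equiv.Perm (Fin n)),
      (∀ s ∈ S, s.IsSwap) → Subgroup.closure S = ⊤ →
      (∀ s ∈ S', s.IsSwap) → Subgroup.closure S' = ⊤ →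
        (Nonempty (leftCayleyGraph S ≃g leftCayleyGraph S') ↔
          Nonempty (transpositionGraph S ≃g transpositionGraph S'))) ∧
    (∀ S : Set (Equiv.Perm (Fin n)),
      (∀ s ∈ S, s.IsSwap) → Subgroup.closure S = ⊤ →
        (IsEdgeTransitive (leftCayleyGraph S) ↔ IsEdgeTransitive (transpositionGraph S))) := by
  refine ⟨fun S S' hS hgen hS' hgen' => ⟨?_, ?_⟩, fun S hS hgen => ⟨?_, ?_⟩⟩
  · rintro ⟨φ⟩
    obtain ⟨σ, -⟩ := exists_transpositionGraph_iso (by omega) hS hgen hS' hgen'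
      (φ.trans (leftCayleyGraph.mulRightIso S' (φ 1)⁻¹)) (mul_inv_cancel (φ 1))
    exact ⟨σ⟩
  · rintro ⟨σ⟩
    obtain ⟨φ, -⟩ := exists_leftCayleyGraph_iso hS hS' σ
    exact ⟨φ⟩
  · intro hT u v x y huv hxy
    have h1 : ∀ i j, (transpositionGraph S).Adj i j → (leftCayleyGraph S).Adj 1 (swap i j) :=
      fun i j h => (leftCayleyGraph_adj_iff hS).2 (by simpa using h.2)
    -- up to a right translation, the automorphism fixes `1` and takes `(u v)` to `(x y)`
    obtain ⟨φ, hφ1, hφ⟩ : ∃ φ : leftCayleyGraph S ≃g leftCayleyGraph S,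
        φ 1 = 1 ∧ φ (swap u v) = swap x y := by
      obtain ⟨g, hg⟩ := hT _ _ _ _ (h1 u v huv) (h1 x y hxy)
      rcases Sym2.eq_iff.1 hg with ⟨ha, hb⟩ | ⟨ha, hb⟩
      · exact ⟨g, ha, hb⟩
      · refine ⟨g.trans (leftCayleyGraph.mulRightIso S (swap x y)), ?_, ?_⟩
        · show g 1 * swap x y = 1
          rw [ha, swap_mul_self]
        · show g (swap u v) * swap x y = swap x y
          rw [hb, one_mul]
    obtain ⟨σ, hσ⟩ := exists_transpositionGraph_iso (by omega) hS hgen hS hgen φ hφ1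
    refine ⟨σ, ?_⟩
    have he : swap (σ u) (σ v) = swap x y := (hσ u v huv).symm.trans hφ
    have hne : σ u ≠ σ v := fun e => huv.1 (σ.injective e)
    have hmv : ∀ z, z = σ u ∨ z = σ v → z = x ∨ z = y := by
      intro z hz
      by_contra! hno
      have := DFunLike.congr_fun he z
      rw [swap_apply_of_ne_of_ne hno.1 hno.2] at this
      rcases hz with rfl | rfl
      · rw [swap_apply_left] at this; exact hne this.symm
      · rw [swap_apply_right] at this; exact hne this
    rw [Sym2.eq_iff]
    rcases hmv _ (Or.inl rfl) with ha | ha <;> rcases hmv _ (Or.inr rfl) with hb | hb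
    · exact absurd (ha.trans hb.symm) hne
    · exact Or.inl ⟨ha, hb⟩
    · exact Or.inr ⟨ha, hb⟩
    · exact absurd (ha.trans hb.symm) hne
  · intro hT u v x y huv hxy
    rw [leftCayleyGraph_adj_iff hS] at huv hxy
    obtain ⟨i, j, hij, hs⟩ := hS _ huv
    obtain ⟨k, l, hkl, ht⟩ := hS _ hxy
    obtain ⟨σ, hσ⟩ := hT i j k l ⟨hij, hs ▸ huv⟩ ⟨hkl, ht ▸ hxy⟩
    obtain ⟨φ, hφ1, hφ⟩ := exists_leftCayleyGraph_iso hS hS σ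
    refine ⟨((leftCayleyGraph.mulRightIso S u⁻¹).trans φ).trans
      (leftCayleyGraph.mulRightIso S x), ?_⟩
    have hsw : swap (σ i) (σ j) = swap k l := by
      rcases Sym2.eq_iff.1 hσ with ⟨ha, hb⟩ | ⟨ha, hb⟩
      · rw [ha, hb]
      · rw [ha, hb, swap_comm]
    show s(φ (u * u⁻¹) * x, φ (v * u⁻¹) * x) = s(x, y)
    rw [mul_inv_cancel, hφ1, one_mul, hs, hφ, hsw, ← ht, inv_mul_cancel_right]
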